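/- For a finite set $\rho=\{r_1,\dots,r_k\}$ of pairwise coprime integers $r_i>1$, put $n_0=\prod_i r_i$, $n_i=n_0/r_i$, $n_{ij}=n_0/(r_ir_j)$ for $i\neq j$, and so on. Define the inclusion-exclusion polynomial $$Q_\rho(z)=\frac{(z^{n_0}-1)\prod_{i<j}(z^{n_{ij}}-1)\cdots}{\prod_i(z^{n_i}-1)\prod_{i<j<l}(z^{n_{ijl}}-1)\cdots},$$ which is a polynomial with integer coefficients. For pairwise coprime $p,q,r>1$, let $A(p,q,r)$ be the largest absolute value of a coefficient of $Q_{\{p,q,r\}}$. Extend this definition by setting $A(p,q,1)=0$. (With this definition $A(p,q,2)=1$ for coprime odd $p,q\ge 3$.) Theorem. Let $p,q\ge 3$ and $r$ be pairwise coprime integers, and let $s$ be an integer such that $r\equiv s\pmod{pq}$ or $r\equiv -s\pmod{pq}$, and $r>\max(p,q)>s\ge 1$. Then $$A(p,q,s)\le A(p,q,r)\le A(p,q,s)+1.$$ -/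

import Mathlib

open Polynomial

/-- The numerator of the inclusion-exclusion fraction of a finite set `ρ` of natural numbers: the
product of `z ^ n_T - 1` over all `T ⊆ ρ` with an even number of elements, where `n_T` is the
product of all elements of `ρ` outside `T`. -/
noncomputable def inclExclNum (ρ : Finset ℕ) : ℤ[X] :=
  ∏ T ∈ ρ.powerset with Even T.card, (X ^ (∏ i ∈ ρ \ T, i) - 1)

/-- The denominator of the inclusion-exclusion fraction: the same product, over all `T ⊆ ρ` with an
odd number of elements. -/
noncomputable def inclExclDen (ρ : Finset ℕ) : ℤ[X] :=
  ∏ T ∈ ρ.powerset with ¬ Even T.card, (X ^ (∏ i ∈ ρ \ T, i) - 1)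

/-- The inclusion-exclusion polynomial `Q_ρ`, numerator divided by denominator. The denominator is
monic, and the division is exact by `inclExclPoly_spec`. -/
noncomputable def inclExclPoly (ρ : Finset ℕ) : ℤ[X] :=
  inclExclNum ρ /ₘ inclExclDen ρ

theorem inclExclDen_monic (ρ : Finset ℕ) (hpos : ∀ i ∈ ρ, 0 < i) : (inclExclDen ρ).Monic := by
  refine monic_prod_of_monic _ _ fun T _ => ?_
  refine monic_X_pow_sub_C (1 : ℤ) (Finset.prod_ne_zero_iff.2 fun i hi => ?_)
  exact (hpos i (Finset.mem_sdiff.1 hi).1).ne'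

theorem inclExcl_prod_eq (ρ : Finset ℕ) (hpos : ∀ i ∈ ρ, 0 < i)
    (hcop : (ρ : Set ℕ).Pairwise Nat.Coprime) (P : ℕ → Prop) [DecidablePred P] :
    ∏ T ∈ ρ.powerset with P T.card, ((X : ℤ[X]) ^ (∏ i ∈ ρ \ T, i) - 1) =
      ∏ d ∈ (∏ i ∈ ρ, i).divisors,
        cyclotomic d ℤ ^ ({T ∈ (ρ.filter (Nat.Coprime d)).powerset | P T.card}).card := by
  have hn0 : (∏ i ∈ ρ, i) ≠ 0 := Finset.prod_ne_zero_iff.2 fun i hi => (hpos i hi).ne'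
  have key : ∀ T ∈ ρ.powerset.filter (fun T => P T.card),
      ((X : ℤ[X]) ^ (∏ i ∈ ρ \ T, i) - 1) = ∏ d ∈ (∏ i ∈ ρ, i).divisors,
        if T ⊆ ρ.filter (Nat.Coprime d) then cyclotomic d ℤ else 1 := by
    intro T hT
    have hTρ : T ⊆ ρ := Finset.mem_powerset.1 (Finset.mem_filter.1 hT).1
    have hmul : (∏ i ∈ ρ \ T, i) * ∏ i ∈ T, i = ∏ i ∈ ρ, i := Finset.prod_sdiff hTρ
    have hpos' : 0 < ∏ i ∈ ρ \ T, i :=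
      Finset.prod_pos fun i hi => hpos i (Finset.mem_sdiff.1 hi).1
    rw [← prod_cyclotomic_eq_X_pow_sub_one hpos', ← Finset.prod_filter]
    refine Finset.prod_congr ?_ fun _ _ => rfl
    ext d
    simp only [Nat.mem_divisors, Finset.mem_filter]
    constructor
    · rintro ⟨hd, -⟩
      refine ⟨⟨hd.trans (Dvd.intro _ hmul), hn0⟩, fun i hi => ?_⟩
      refine Finset.mem_filter.2 ⟨hTρ hi, Nat.Coprime.coprime_dvd_left hd ?_⟩
      refine Nat.Coprime.prod_left fun j hj => ?_
      have hj' := Finset.mem_sdiff.1 hj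
      exact hcop hj'.1 (hTρ hi) (fun h => hj'.2 (h ▸ hi))
    · rintro ⟨⟨hd, -⟩, hsub⟩
      refine ⟨?_, hpos'.ne'⟩
      rw [← hmul] at hd
      exact Nat.Coprime.dvd_of_dvd_mul_right
        (Nat.Coprime.prod_right fun i hi => (Finset.mem_filter.1 (hsub hi)).2) hd
  rw [Finset.prod_congr rfl key, Finset.prod_comm]
  refine Finset.prod_congr rfl fun d _ => ?_
  rw [← Finset.prod_filter, Finset.prod_const]
  congr 2
  ext T
  simp only [Finset.mem_filter, Finset.mem_powerset]
  constructor
  · rintro ⟨⟨_, h2⟩, h3⟩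
    exact ⟨h3, h2⟩
  · rintro ⟨h1, h2⟩
    exact ⟨⟨h1.trans (Finset.filter_subset _ _), h2⟩, h1⟩

/-- For pairwise coprime positive parameters the division defining `Q_ρ` leaves no remainder. -/
theorem inclExclPoly_spec (ρ : Finset ℕ) (hpos : ∀ i ∈ ρ, 0 < i)
    (hcop : (ρ : Set ℕ).Pairwise Nat.Coprime) :
    inclExclDen ρ * inclExclPoly ρ = inclExclNum ρ := by
  have hdvd : inclExclDen ρ ∣ inclExclNum ρ := by
    rw [inclExclDen, inclExclNum, inclExcl_prod_eq ρ hpos hcop (fun n => Even n),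
      inclExcl_prod_eq ρ hpos hcop (fun n => ¬ Even n)]
    refine Finset.prod_dvd_prod_of_dvd _ _ fun d _ => pow_dvd_pow _ ?_
    set C := ρ.filter (Nat.Coprime d)
    have h := Finset.sum_powerset_neg_one_pow_card (x := C)
    rw [← Finset.sum_filter_add_sum_filter_not C.powerset (fun T => Even T.card),
      Finset.sum_congr rfl fun T hT => (Finset.mem_filter.1 hT).2.neg_one_pow,
      Finset.sum_congr (s₁ := C.powerset.filter fun T => ¬ Even T.card) rfl fun T hT =>
        (Nat.not_even_iff_odd.1 (Finset.mem_filter.1 hT).2).neg_one_pow] at h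
    simp only [Finset.sum_const, nsmul_eq_mul, mul_one, mul_neg] at h
    split_ifs at h <;> omega
  have hmod := (modByMonic_eq_zero_iff_dvd (inclExclDen_monic ρ hpos)).2 hdvd
  have hdiv := modByMonic_add_div (inclExclNum ρ) (inclExclDen ρ)
  rwa [hmod, zero_add] at hdiv

/-- The largest absolute value of a coefficient of `Q_ρ`. -/
noncomputable def inclExclHeight (ρ : Finset ℕ) : ℕ :=
  (inclExclPoly ρ).support.sup fun m => ((inclExclPoly ρ).coeff m).natAbs

/-- `A(p, q, r)`: the largest absolute value of a coefficient of `Q_{p,q,r}`, extended to `r = 1` by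
the convention `A(p, q, 1) = 0`. -/
noncomputable def ternaryHeight (p q r : ℕ) : ℕ :=
  if r = 1 then 0 else inclExclHeight {p, q, r}

/-! With W(z) = (1-z^p)(1-z^q)/((1-z^(pq))(1-z)) one has Q_{p,q,r}(z) = Q_{p,q}(z^r) W(z), and for p
< q the coefficients of W are the pq-periodic `window`. Hence the coefficient at n is S_r(M,t) =
`windowSum p q r M t` with M = ⌊n/r⌋ and t = n (`inclExclPoly_triple_coeff`). S_r depends on r and t
only modulo pq, and r ↦ -r only changes its sign and reflects t (`windowSum_neg`), so r and s give
the same values up to sign. What differs is which pairs (M,t) the height sees: those whose position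
x = (t - rM) mod pq can be taken below r.

For r > q this restriction costs nothing (`abs_windowSum_le`), which gives A(p,q,s) ≤ A(p,q,r). For
s ≥ 2 any position can be moved below s at cost at most 1 (`abs_windowSum_le_add_one`): changing M
by one moves x by s, and where the window is constant the coefficients of Q_{p,q}, being differences
of the indicator of the semigroup ⟨p,q⟩, telescope. For s = 1 the identity Q_{p,q} W = 1 replaces
the height bound (`abs_windowSum_one_le_one`). -/

open Classical in
/-- The indicator function of the numerical semigroup generated by `p` and `q`. -/
noncomputable def semigroupInd (p q n : ℤ) : ℤ :=
  if ∃ a b : ℤ, 0 ≤ a ∧ 0 ≤ b ∧ n = a * p + b * q then 1 else 0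

/-- The coefficients of the binary inclusion-exclusion polynomial `Q_{p,q}`. -/
noncomputable def binaryCoeff (p q m : ℤ) : ℤ := semigroupInd p q m - semigroupInd p q (m - 1)

/-- The `p * q`-periodic function equal to `1` on `[0, p)`, to `-1` on `[q, q + p)`, and to `0` on
the rest of `[0, p * q)`. -/
def window (p q x : ℤ) : ℤ :=
  if x % (p * q) < p then 1 else if q ≤ x % (p * q) ∧ x % (p * q) < q + p then -1 else 0

/-- The partial sums that give the coefficients of ternary inclusion-exclusion polynomials. -/
noncomputable def windowSum (p q r M t : ℤ) : ℤ :=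
  ∑ m ∈ Finset.range (M + 1).toNat, binaryCoeff p q m * window p q (t - r * m)

/-! ### The numerical semigroup generated by p and q. -/

section Semigroup

variable {p q : ℤ}

theorem semigroupInd_zero_or_one (p q n : ℤ) :
    semigroupInd p q n = 0 ∨ semigroupInd p q n = 1 := by
  unfold semigroupInd; split_ifs <;> simp

theorem semigroupInd_of_neg (hp : 0 < p) (hq : 0 < q) {n : ℤ} (hn : n < 0) :
    semigroupInd p q n = 0 := by
  refine if_neg ?_
  rintro ⟨a, b, ha, hb, rfl⟩
  have := mul_nonneg ha hp.le
  have := mul_nonneg hb hq.le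
  omega

/-- All representations of n differ by multiples of (q, -p), so the one with first coefficient in
[0, q) has the largest second coefficient. -/
theorem semigroupInd_eq_ite (hp : 0 < p) (hq : 0 < q) (hpq : IsCoprime p q) {i j : ℤ} (hi : 0 ≤ i)
    (hiq : i < q) : semigroupInd p q (i * p + j * q) = if 0 ≤ j then 1 else 0 := by
  unfold semigroupInd
  congr 1
  refine propext ⟨?_, fun hj => ⟨i, j, hi, hj, rfl⟩⟩
  rintro ⟨a, b, ha, hb, h⟩
  have hdvd : q ∣ a - i := by
    refine hpq.symm.dvd_of_dvd_mul_right ⟨j - b, ?_⟩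
    linarith
  obtain ⟨k, hk⟩ := hdvd
  have hk0 : 0 ≤ k := by
    by_contra! hk0
    nlinarith
  have hjb : j = b + k * p := by
    have : q * j = q * (b + k * p) := by
      have : a = i + q * k := by omega
      subst this
      linarith
    exact mul_left_cancel₀ hq.ne' this
  have := mul_nonneg hk0 hp.le
  omega

theorem exists_eq_mul_add_mul (hq : 0 < q) (hpq : IsCoprime p q) (n : ℤ) :
    ∃ i j : ℤ, 0 ≤ i ∧ i < q ∧ n = i * p + j * q := by
  obtain ⟨u, v, h⟩ := hpq
  refine ⟨(n * u) % q, n * v + (n * u) / q * p, Int.emod_nonneg _ hq.ne', Int.emod_lt_of_pos _ hq, ?_⟩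
  have := Int.emod_add_mul_ediv (n * u) q
  linear_combination (-n) * h - p * this

/-- Coefficient form of (1-z^p)(1-z^q) Σ z^n = 1 - z^(pq), the sum running over the semigroup. -/
theorem semigroupInd_recurrence (hp : 0 < p) (hq : 0 < q) (hpq : IsCoprime p q) (n : ℤ) :
    semigroupInd p q n - semigroupInd p q (n - p) -
      (semigroupInd p q (n - q) - semigroupInd p q (n - q - p)) =
      (if n = 0 then 1 else 0) - (if n = p * q then 1 else 0) := by
  obtain ⟨i, j, hi, hiq, rfl⟩ := exists_eq_mul_add_mul hq hpq n
  rw [semigroupInd_eq_ite hp hq hpq hi hiq,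
    show i * p + j * q - q = i * p + (j - 1) * q by ring, semigroupInd_eq_ite hp hq hpq hi hiq]
  rcases hi.eq_or_lt with rfl | hi0
  -- At i = 0, subtracting p leaves the range [0, q), so pq is borrowed from the second term.
  · rw [show 0 * p + j * q - p = (q - 1) * p + (j - p) * q by ring,
      show 0 * p + (j - 1) * q - p = (q - 1) * p + (j - 1 - p) * q by ring,
      semigroupInd_eq_ite hp hq hpq (by omega) (by omega),
      semigroupInd_eq_ite hp hq hpq (by omega) (by omega)]
    have h0 : 0 * p + j * q = 0 ↔ j = 0 := by simp [hq.ne']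
    have h1 : 0 * p + j * q = p * q ↔ j = p := by simp [hq.ne']
    simp only [h0, h1]
    split_ifs <;> omega
  · rw [show i * p + j * q - p = (i - 1) * p + j * q by ring,
      show i * p + (j - 1) * q - p = (i - 1) * p + (j - 1) * q by ring,
      semigroupInd_eq_ite hp hq hpq (by omega) (by omega),
      semigroupInd_eq_ite hp hq hpq (by omega) (by omega)]
    have hnd : ∀ k : ℤ, i * p + j * q ≠ k * q := by
      intro k h
      have hdvd : q ∣ i := hpq.symm.dvd_of_dvd_mul_right ⟨k - j, by linarith⟩
      have := Int.le_of_dvd hi0 hdvd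
      omega
    have h0 : i * p + j * q ≠ 0 := by
      have := hnd 0
      rwa [zero_mul] at this
    rw [if_neg h0, if_neg (hnd p)]
    omega

theorem semigroupInd_sub_left_le (n : ℤ) :
    semigroupInd p q (n - p) ≤ semigroupInd p q n := by
  by_cases h : ∃ a b : ℤ, 0 ≤ a ∧ 0 ≤ b ∧ n - p = a * p + b * q
  · obtain ⟨a, b, ha, hb, hab⟩ := h
    have : semigroupInd p q n = 1 := if_pos ⟨a + 1, b, by omega, hb, by linarith⟩
    rcases semigroupInd_zero_or_one p q (n - p) with h | h <;> omega
  · have : semigroupInd p q (n - p) = 0 := if_neg h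
    rcases semigroupInd_zero_or_one p q n with h | h <;> omega

theorem semigroupInd_comm (p q n : ℤ) : semigroupInd p q n = semigroupInd q p n := by
  unfold semigroupInd
  congr 1
  refine propext ⟨?_, ?_⟩ <;> rintro ⟨a, b, ha, hb, h⟩ <;> exact ⟨b, a, hb, ha, by linarith⟩

theorem semigroupInd_sub_right_le (n : ℤ) :
    semigroupInd p q (n - q) ≤ semigroupInd p q n := by
  rw [semigroupInd_comm p, semigroupInd_comm p]
  exact semigroupInd_sub_left_le n

theorem semigroupInd_le_add {n : ℤ} (hn : n ≠ 0) :
    semigroupInd p q n ≤ semigroupInd p q (n - p) + semigroupInd p q (n - q) := by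
  have h1 := semigroupInd_zero_or_one p q (n - p)
  have h2 := semigroupInd_zero_or_one p q (n - q)
  by_cases h : ∃ a b : ℤ, 0 ≤ a ∧ 0 ≤ b ∧ n = a * p + b * q
  · have h3 : semigroupInd p q n = 1 := if_pos h
    obtain ⟨a, b, ha, hb, hab⟩ := h
    rcases ha.eq_or_lt with rfl | ha0
    · rcases hb.eq_or_lt with rfl | hb0
      · simp [hab] at hn
      · have : semigroupInd p q (n - q) = 1 := if_pos ⟨0, b - 1, le_rfl, by omega, by linarith⟩
        omega
    · have : semigroupInd p q (n - p) = 1 := if_pos ⟨a - 1, b, by omega, hb, by linarith⟩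
      omega
  · have : semigroupInd p q n = 0 := if_neg h
    omega

end Semigroup

/-! ### Symmetry of the window. -/

section Window

variable {p q : ℤ}

theorem window_congr {x y : ℤ} (h : x ≡ y [ZMOD p * q]) : window p q x = window p q y := by
  unfold window; rw [h]

theorem window_eq_of_modEq {x y : ℤ} (h : x ≡ y [ZMOD p * q]) (hy : 0 ≤ y) (hy' : y < p * q) :
    window p q x = if y < p then 1 else if q ≤ y ∧ y < q + p then -1 else 0 := by
  rw [window_congr h, window, Int.emod_eq_of_lt hy hy']

theorem add_le_mul_of_lt (hp : 2 ≤ p) (hpq : p < q) : q + p ≤ p * q := by nlinarith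

/-- The reflection exchanges the blocks [0, p) and [q, q + p), which carry opposite signs. -/
theorem window_reflect (hp : 2 ≤ p) (hpq : p < q) (x : ℤ) :
    window p q (p + q - 1 - x) = -window p q x := by
  have hle := add_le_mul_of_lt hp hpq
  have hN : 0 < p * q := by nlinarith
  set N := p * q with hN'
  have hx0 := Int.emod_nonneg x hN.ne'
  have hx1 := Int.emod_lt_of_pos x hN
  have hmod : x ≡ x % N [ZMOD N] := (Int.mod_modEq x N).symm
  rw [window_eq_of_modEq hmod hx0 hx1]
  set y := x % N
  have hsub : p + q - 1 - x ≡ p + q - 1 - y [ZMOD N] := Int.ModEq.sub_left _ hmod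
  by_cases hy : y ≤ p + q - 1
  · rw [window_eq_of_modEq hsub (by omega) (by omega)]
    split_ifs <;> omega
  · have hsub' : p + q - 1 - x ≡ p + q - 1 - y + N [ZMOD N] := by
      simpa using hsub.trans (Int.ModEq.symm (Int.add_modEq_right))
    rw [window_eq_of_modEq hsub' (by omega) (by omega)]
    split_ifs <;> omega

end Window

/-! ### Moving positions in the partial sums. -/

section WindowSum

variable {p q : ℤ}

theorem windowSum_of_neg {r M t : ℤ} (hM : M < 0) : windowSum p q r M t = 0 := by
  rw [windowSum, show (M + 1).toNat = 0 by omega, Finset.sum_range_zero]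

theorem windowSum_step (hp : 0 < p) (hq : 0 < q) (r M t : ℤ) :
    windowSum p q r M t =
      windowSum p q r (M - 1) t + binaryCoeff p q M * window p q (t - r * M) := by
  -- The step also holds for M < 0, where every term vanishes, so M may later be lowered freely.
  rcases lt_or_ge M 0 with hM | hM
  · rw [windowSum_of_neg hM, windowSum_of_neg (by omega), binaryCoeff,
      semigroupInd_of_neg hp hq hM, semigroupInd_of_neg hp hq (by omega)]
    simp
  · lift M to ℕ using hM
    rw [windowSum, windowSum, show ((M : ℤ) + 1).toNat = M + 1 by omega,
      show ((M : ℤ) - 1 + 1).toNat = M by omega, Finset.sum_range_succ]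

theorem windowSum_congr {r r' t t' : ℤ} (hr : r ≡ r' [ZMOD p * q]) (ht : t ≡ t' [ZMOD p * q])
    (M : ℤ) : windowSum p q r M t = windowSum p q r' M t' :=
  Finset.sum_congr rfl fun _ _ => by rw [window_congr (ht.sub (hr.mul_right _))]

theorem windowSum_neg (hp : 2 ≤ p) (hpq : p < q) (r M t : ℤ) :
    windowSum p q (-r) M t = -windowSum p q r M (p + q - 1 - t) := by
  rw [windowSum, windowSum, ← Finset.sum_neg_distrib]
  refine Finset.sum_congr rfl fun m _ => ?_
  rw [show p + q - 1 - t - r * m = p + q - 1 - (t - -r * m) by ring, window_reflect hp hpq]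
  ring

/-- On a stretch where the window is constant, the sum of `binaryCoeff` telescopes. -/
theorem windowSum_sub_of_window_eq (hp : 0 < p) (hq : 0 < q) {r M t ε : ℤ} (j : ℕ)
    (h : ∀ i : ℕ, i < j → window p q (t - r * (M - i)) = ε) :
    windowSum p q r M t - windowSum p q r (M - j) t =
      ε * (semigroupInd p q M - semigroupInd p q (M - j)) := by
  induction j with
  | zero => simp
  | succ j ih =>
    have hih := ih fun i hi => h i (by omega)
    have hstep := windowSum_step hp hq r (M - j) t
    rw [h j (by omega), binaryCoeff] at hstep
    push_cast
    rw [show M - ((j : ℤ) + 1) = M - j - 1 by ring]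
    linear_combination hih + hstep

/-- k counts the first j terms of the increasing progression that lie below b. -/
theorem exists_threshold {x₀ s : ℤ} (hs : 0 < s) (b : ℤ) (j : ℕ) :
    ∃ k : ℕ, k ≤ j ∧ (∀ i : ℕ, i < k → x₀ + i * s < b) ∧
      ∀ i : ℕ, k ≤ i → i < j → b ≤ x₀ + i * s := by
  induction j with
  | zero => exact ⟨0, le_rfl, by simp, by simp⟩
  | succ j ih =>
    obtain ⟨k, hkj, h1, h2⟩ := ih
    rcases hkj.eq_or_lt with rfl | hlt
    · by_cases hb : x₀ + k * s < b
      · refine ⟨k + 1, le_rfl, fun i hi => ?_, fun i hi hi' => by omega⟩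
        rcases (Nat.lt_succ_iff.1 hi).eq_or_lt with rfl | hi'
        · exact hb
        · exact h1 i hi'
      · refine ⟨k, by omega, h1, fun i hi hi' => ?_⟩
        obtain rfl : i = k := by omega
        omega
    · refine ⟨k, by omega, h1, fun i hi hi' => ?_⟩
      rcases (Nat.lt_succ_iff.1 hi').eq_or_lt with rfl | hi''
      · have := h2 k le_rfl hlt
        have : (k : ℤ) * s ≤ i * s := by
          refine mul_le_mul_of_nonneg_right ?_ hs.le
          omega
        omega
      · exact h2 i hi hi''

/-- If along an arithmetic progression of positions the window first takes the value `ε` below a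
threshold and then vanishes, then the corresponding partial sums differ by at most `1`. -/
theorem abs_windowSum_sub_le_one (hp : 0 < p) (hq : 0 < q) {s M t x₀ b ε : ℤ} (hs : 0 < s)
    (hε : |ε| ≤ 1) (j : ℕ)
    (h1 : ∀ i : ℕ, i < j → x₀ + i * s < b → window p q (t - s * (M - i)) = ε)
    (h2 : ∀ i : ℕ, i < j → b ≤ x₀ + i * s → window p q (t - s * (M - i)) = 0) :
    |windowSum p q s M t - windowSum p q s (M - j) t| ≤ 1 := by
  obtain ⟨k, hkj, hk1, hk2⟩ := exists_threshold (x₀ := x₀) hs b j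
  have e1 := windowSum_sub_of_window_eq hp hq (r := s) (M := M) (t := t) (ε := ε) k
    fun i hi => h1 i (by omega) (hk1 i hi)
  have e2 := windowSum_sub_of_window_eq hp hq (r := s) (M := M - k) (t := t) (ε := 0) (j - k)
    fun i hi => by
      have := h2 (k + i) (by omega) (hk2 _ (by omega) (by omega))
      rw [← this]
      push_cast
      ring_nf
  rw [show M - (k : ℤ) - ((j - k : ℕ) : ℤ) = M - j by omega, zero_mul] at e2
  rw [show windowSum p q s M t - windowSum p q s (M - j) t =
    ε * (semigroupInd p q M - semigroupInd p q (M - k)) by linarith, abs_mul]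
  have h3 : |semigroupInd p q M - semigroupInd p q (M - k)| ≤ 1 := by
    rcases semigroupInd_zero_or_one p q M with h | h <;>
      rcases semigroupInd_zero_or_one p q (M - k) with h' | h' <;> rw [h, h'] <;> norm_num
  exact mul_le_one₀ hε (abs_nonneg _) h3

theorem modEq_sub_mul_emod (N s M t : ℤ) (i : ℤ) :
    t - s * (M - i) ≡ (t - s * M) % N + i * s [ZMOD N] := by
  have := (Int.mod_modEq (t - s * M) N).symm.add_right (i * s)
  rwa [show t - s * M + i * s = t - s * (M - i) by ring] at this

/-- A position `x ≥ q + p` in `[0, p * q)` can be moved past `p * q` without changing the partial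
sum. -/
theorem abs_windowSum_le_of_add_le (hp : 2 ≤ p) (hpq : p < q) {r B : ℤ} (hr : 0 < r)
    (hB : ∀ M t x : ℤ, 0 ≤ x → x < r → t ≡ r * M + x [ZMOD p * q] → |windowSum p q r M t| ≤ B)
    {M t : ℤ} (hx : q + p ≤ (t - r * M) % (p * q)) : |windowSum p q r M t| ≤ B := by
  have hN : 0 < p * q := by nlinarith
  have hx1 := Int.emod_lt_of_pos (t - r * M) hN
  have hmod := modEq_sub_mul_emod (p * q) r M t
  set N := p * q
  set x := (t - r * M) % N
  -- Since r ≥ 1, N - x steps are enough to reach N.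
  obtain ⟨k, hkj, hk1, hk2⟩ := exists_threshold (x₀ := x) hr N (N - x).toNat
  have hkN : N ≤ x + k * r := by
    rcases hkj.eq_or_lt with rfl | h
    · nlinarith [Int.toNat_of_nonneg (show 0 ≤ N - x by omega)]
    · exact hk2 k le_rfl h
  have hk0 : k ≠ 0 := by
    rintro rfl
    simp at hkN
    omega
  -- The previous position is still below N, so the overshoot past N is less than r.
  have hkl := hk1 (k - 1) (by omega)
  rw [Nat.cast_sub (by omega), sub_mul] at hkl
  have e := windowSum_sub_of_window_eq (p := p) (q := q) (by omega) (by omega) (r := r) (M := M)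
    (t := t) (ε := 0) k fun i hi => by
      have : 0 ≤ (i : ℤ) * r := by positivity
      rw [window_eq_of_modEq (hmod i) (by omega) (hk1 i hi), if_neg (by omega), if_neg (by omega)]
  rw [zero_mul, sub_eq_zero] at e
  rw [e]
  refine hB _ _ (x + k * r - N) (by omega) (by push_cast at hkl; omega) ?_
  have := (hmod k).add_left (r * (M - k))
  rw [show r * (M - k) + (t - r * (M - k)) = t by ring] at this
  refine this.trans ?_
  rw [show r * (M - (k : ℤ)) + (x + k * r - N) = r * (M - k) + (x + k * r) - N by ring]
  exact Int.ModEq.symm (by simp)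

/-- The only hard positions are r ≤ x < q + p. There the window is -1 at x and, as r > q, it is 1 at
x - r. The sums for M - 1 and M + 1 are bounded by B and enclose the one for M. -/
theorem abs_windowSum_le (hp : 2 ≤ p) (hpq : p < q) {r B : ℤ} (hr : q < r)
    (hB : ∀ M t x : ℤ, 0 ≤ x → x < r → t ≡ r * M + x [ZMOD p * q] → |windowSum p q r M t| ≤ B)
    (M t : ℤ) : |windowSum p q r M t| ≤ B := by
  have hle := add_le_mul_of_lt hp hpq
  have hN : 0 < p * q := by nlinarith
  have hp0 : 0 < p := by omega
  have hq0 : 0 < q := by omega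
  have hx0 := Int.emod_nonneg (t - r * M) hN.ne'
  have hx1 := Int.emod_lt_of_pos (t - r * M) hN
  have hmod := modEq_sub_mul_emod (p * q) r M t
  have main : ∀ M t : ℤ, (t - r * M) % (p * q) < r → |windowSum p q r M t| ≤ B := by
    intro M t h
    refine hB M t _ (Int.emod_nonneg _ hN.ne') h ?_
    have := (modEq_sub_mul_emod (p * q) r M t 0).add_left (r * M)
    simpa using this
  rcases lt_or_ge ((t - r * M) % (p * q)) r with hxr | hxr
  · exact main M t hxr
  rcases le_or_gt (q + p) ((t - r * M) % (p * q)) with hx | hx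
  · exact abs_windowSum_le_of_add_le hp hpq (by omega) hB hx
  -- The position x + r either lies in the zero stretch [q + p, pq) or wraps to a value below r.
  have hbelow : |windowSum p q r (M - 1) t| ≤ B := by
    have h1 := hmod 1
    rw [one_mul] at h1
    rcases lt_or_ge ((t - r * M) % (p * q) + r) (p * q) with h | h
    · refine abs_windowSum_le_of_add_le hp hpq (by omega) hB ?_
      rw [h1, Int.emod_eq_of_lt (by omega) h]
      omega
    · refine main _ _ ?_
      rw [h1, ← Int.sub_emod_right, Int.emod_eq_of_lt (by omega) (by omega)]
      omega
  have habove : |windowSum p q r (M + 1) t| ≤ B := by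
    refine main _ _ ?_
    have h1 := hmod (-1)
    rw [show M - -1 = M + 1 by ring] at h1
    rw [h1, Int.emod_eq_of_lt (by omega) (by omega)]
    omega
  have s1 := windowSum_step hp0 hq0 r M t
  have s2 := windowSum_step hp0 hq0 r (M + 1) t
  have w1 := window_eq_of_modEq (hmod 0) (by omega) (by omega)
  have w2 := window_eq_of_modEq (hmod (-1)) (by omega) (by omega)
  rw [if_neg (by omega), if_pos (by omega), sub_zero] at w1
  rw [if_pos (by omega), show M - -1 = M + 1 by ring] at w2
  rw [w1, binaryCoeff] at s1
  rw [w2, binaryCoeff, add_sub_cancel_right] at s2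
  -- If M is in the semigroup, S(M + 1) ≤ S(M) ≤ S(M - 1); otherwise both inequalities reverse.
  rw [abs_le] at hbelow habove ⊢
  rcases semigroupInd_zero_or_one p q M with h | h <;>
    rcases semigroupInd_zero_or_one p q (M - 1) with h' | h' <;>
    rcases semigroupInd_zero_or_one p q (M + 1) with h'' | h'' <;>
    rw [h, h'] at s1 <;> rw [h, h''] at s2 <;> constructor <;> omega

/-- From x < q, raising M moves down to x mod s through window values 0 and then 1; from x ≥ q,
lowering M moves up past pq through values -1 and then 0. Either way one telescoped difference of
indicators is paid. -/
theorem abs_windowSum_le_add_one (hp : 2 ≤ p) (hpq : p < q) {s B : ℤ} (hs : 0 < s)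
    (hB : ∀ M t x : ℤ, 0 ≤ x → x < s → t ≡ s * M + x [ZMOD p * q] → |windowSum p q s M t| ≤ B)
    (M t : ℤ) : |windowSum p q s M t| ≤ B + 1 := by
  have hle := add_le_mul_of_lt hp hpq
  have hN : 0 < p * q := by nlinarith
  have hp0 : 0 < p := by omega
  have hq0 : 0 < q := by omega
  have hx0 := Int.emod_nonneg (t - s * M) hN.ne'
  have hx1 := Int.emod_lt_of_pos (t - s * M) hN
  have hmod := modEq_sub_mul_emod (p * q) s M t
  set x := (t - s * M) % (p * q)
  rcases lt_or_ge x q with hxq | hxq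
  · have hd0 : 0 ≤ x / s := Int.ediv_nonneg hx0 hs.le
    have hdiv := Int.emod_add_mul_ediv x s
    have hm0 := Int.emod_nonneg x hs.ne'
    have hm1 := Int.emod_lt_of_pos x hs
    set x₀ := x % s
    obtain ⟨j, hj⟩ := Int.eq_ofNat_of_zero_le hd0
    rw [hj] at hdiv
    have hpos : ∀ i : ℤ, t - s * (M + j - i) ≡ x₀ + i * s [ZMOD p * q] := by
      intro i
      have := hmod (i - j)
      rw [← hdiv] at this
      convert this using 1 <;> ring
    have h := abs_windowSum_sub_le_one hp0 hq0 (s := s) (M := M + j) (t := t) (x₀ := x₀) (b := p)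
      (ε := 1) hs (by norm_num) j
      (fun i hi hlt => by
        have : 0 ≤ (i : ℤ) * s := by positivity
        rw [window_eq_of_modEq (hpos i) (by omega) (by omega), if_pos hlt])
      (fun i hi hge => by
        have h1 : (i : ℤ) * s ≤ j * s :=
          mul_le_mul_of_nonneg_right (by omega) hs.le
        rw [mul_comm s] at hdiv
        have : 0 ≤ (i : ℤ) * s := by positivity
        rw [window_eq_of_modEq (hpos i) (by omega) (by omega), if_neg (by omega),
          if_neg (by omega)])
    have h0 := hB (M + j) t x₀ hm0 hm1 (by
      have := (hpos 0).add_left (s * (M + j))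
      simpa using this)
    rw [add_sub_cancel_right] at h
    rw [abs_le] at h h0 ⊢
    omega
  · obtain ⟨j, hkj, hk1, hk2⟩ := exists_threshold (x₀ := x) hs (p * q) (p * q - x).toNat
    have hkN : p * q ≤ x + j * s := by
      rcases hkj.eq_or_lt with rfl | h
      · nlinarith [Int.toNat_of_nonneg (show 0 ≤ p * q - x by omega)]
      · exact hk2 j le_rfl h
    have hk0 : j ≠ 0 := by
      rintro rfl
      simp at hkN
      omega
    have hkl := hk1 (j - 1) (by omega)
    rw [Nat.cast_sub (by omega), sub_mul] at hkl
    have h := abs_windowSum_sub_le_one hp0 hq0 (s := s) (M := M) (t := t) (x₀ := x) (b := q + p)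
      (ε := -1) hs (by norm_num) j
      (fun i hi hlt => by
        have : 0 ≤ (i : ℤ) * s := by positivity
        rw [window_eq_of_modEq (hmod i) (by omega) (hk1 i hi), if_neg (by omega),
          if_pos (by omega)])
      (fun i hi hge => by
        have : 0 ≤ (i : ℤ) * s := by positivity
        rw [window_eq_of_modEq (hmod i) (by omega) (hk1 i hi), if_neg (by omega),
          if_neg (by omega)])
    have h0 := hB (M - j) t (x + j * s - p * q) (by omega) (by push_cast at hkl; omega) (by
      have := (hmod j).add_left (s * (M - j))
      rw [show s * (M - j) + (t - s * (M - j)) = t by ring] at this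
      refine this.trans ?_
      rw [show s * (M - (j : ℤ)) + (x + j * s - p * q) =
        s * (M - j) + (x + j * s) - p * q by ring]
      exact Int.ModEq.symm (by simp))
    rw [abs_le] at h h0 ⊢
    omega

/-- With s = 1 every position is visited, so moving from position x to 0 evaluates the sum
explicitly through the indicator. -/
theorem abs_windowSum_one_le_one (hp : 2 ≤ p) (hpq : p < q)
    (h0 : ∀ M t : ℤ, t ≡ M [ZMOD p * q] → windowSum p q 1 M t = if M = 0 then 1 else 0)
    (M t : ℤ) : |windowSum p q 1 M t| ≤ 1 := by
  have hle := add_le_mul_of_lt hp hpq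
  have hN : 0 < p * q := by nlinarith
  have hp0 : 0 < p := by omega
  have hq0 : 0 < q := by omega
  have hx0 := Int.emod_nonneg (t - 1 * M) hN.ne'
  have hx1 := Int.emod_lt_of_pos (t - 1 * M) hN
  have hmod := modEq_sub_mul_emod (p * q) 1 M t
  have hB : ∀ M t x : ℤ, 0 ≤ x → x < 1 → t ≡ 1 * M + x [ZMOD p * q] →
      |windowSum p q 1 M t| ≤ 1 := by
    intro M t x hx hx' ht
    obtain rfl : x = 0 := by omega
    rw [h0 M t (by simpa using ht)]
    split_ifs <;> simp
  rcases lt_or_ge M 0 with hM | hM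
  · simp [windowSum_of_neg hM]
  rcases le_or_gt (q + p) ((t - 1 * M) % (p * q)) with hx | hx
  · exact abs_windowSum_le_of_add_le hp hpq one_pos hB hx
  set x := (t - 1 * M) % (p * q)
  have hpos : ∀ i : ℤ, t - 1 * (M + x - i) ≡ i [ZMOD p * q] := by
    intro i
    have := hmod (i - x)
    convert this using 1 <;> ring
  have hst := h0 (M + x) t (by simpa using (hpos 0).add_right (M + x))
  rcases hx0.eq_or_lt with hxe | hxpos
  · rw [← hxe, add_zero] at hst
    rw [hst]
    split_ifs <;> simp
  rw [if_neg (by omega)] at hst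
  have move : ∀ (y j ε : ℤ), 0 ≤ y → 0 ≤ j → y + j ≤ x →
      (∀ i : ℤ, y ≤ i → i < y + j →
        (if i < p then (1 : ℤ) else if q ≤ i ∧ i < q + p then -1 else 0) = ε) →
      windowSum p q 1 (M + x - y) t - windowSum p q 1 (M + x - y - j) t =
        ε * (semigroupInd p q (M + x - y) - semigroupInd p q (M + x - y - j)) := by
    intro y j ε hy hj hyj hw
    lift j to ℕ using hj
    refine windowSum_sub_of_window_eq hp0 hq0 j fun i hi => ?_
    have := hpos (y + i)
    rw [show M + x - (y + i) = M + x - y - i by ring] at this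
    rw [window_eq_of_modEq this (by omega) (by omega)]
    exact hw _ (by omega) (by omega)
  have hM' : M + x - x = M := by ring
  rcases le_or_gt x p with hxp | hxp
  · have e := move 0 x 1 le_rfl hx0 (by omega) fun i hi hi' => if_pos (by omega)
    rw [sub_zero, hM', hst] at e
    rw [abs_le]
    rcases semigroupInd_zero_or_one p q M with h | h <;>
      rcases semigroupInd_zero_or_one p q (M + x) with h' | h' <;>
      rw [h, h'] at e <;> constructor <;> omega
  have e1 := move 0 p 1 le_rfl hp0.le (by omega) fun i hi hi' => if_pos (by omega)
  rw [sub_zero, hst] at e1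
  rcases le_or_gt x q with hxq | hxq
  · have e2 := move p (x - p) 0 hp0.le (by omega) (by omega) fun i hi hi' => by
      rw [if_neg (by omega), if_neg (by omega)]
    rw [show M + x - p - (x - p) = M by ring, zero_mul] at e2
    rw [abs_le]
    rcases semigroupInd_zero_or_one p q (M + x - p) with h | h <;>
      rcases semigroupInd_zero_or_one p q (M + x) with h' | h' <;>
      rw [h, h'] at e1 <;> constructor <;> omega
  have e2 := move p (q - p) 0 hp0.le (by omega) (by omega) fun i hi hi' => by
    rw [if_neg (by omega), if_neg (by omega)]
  rw [show M + x - p - (q - p) = M + x - q by ring, zero_mul] at e2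
  have e3 := move q (x - q) (-1) hq0.le (by omega) (by omega) fun i hi hi' => by
    rw [if_neg (by omega), if_pos (by omega)]
  rw [show M + x - q - (x - q) = M by ring] at e3
  -- With n = M + x and χ the indicator, the sum is χ(n-p) + χ(n-q) - χ(n) - χ(M). The first three
  -- terms add up to 0 or 1.
  have g1 := semigroupInd_sub_left_le (p := p) (q := q) (M + x)
  have g2 := semigroupInd_sub_right_le (p := p) (q := q) (M + x)
  have g3 := semigroupInd_le_add (p := p) (q := q) (n := M + x) (by omega)
  have g4 := semigroupInd_zero_or_one p q M
  have g5 := semigroupInd_zero_or_one p q (M + x)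
  have g6 := semigroupInd_zero_or_one p q (M + x - p)
  have g7 := semigroupInd_zero_or_one p q (M + x - q)
  rw [abs_le]
  constructor <;> omega

end WindowSum

/-! ### Generating functions of the indicator and the window. -/

section Series

/-- The power series whose coefficients are the values of `f` at the natural numbers. -/
noncomputable def intSeries (f : ℤ → ℤ) : PowerSeries ℤ := PowerSeries.mk fun n => f n

theorem intSeries_mul_one_sub_X_pow {f : ℤ → ℤ} (hf : ∀ n < 0, f n = 0) (k : ℕ) :
    intSeries f * (1 - PowerSeries.X ^ k) = intSeries fun n => f n - f (n - k) := by
  ext n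
  rw [mul_sub, mul_one, map_sub, PowerSeries.coeff_mul_X_pow']
  simp only [intSeries, PowerSeries.coeff_mk]
  split_ifs with h
  · rw [Nat.cast_sub h]
  · rw [hf (n - k) (by omega)]

theorem intSeries_single (k : ℕ) :
    intSeries (fun n => if n = k then 1 else 0) = PowerSeries.X ^ k := by
  ext n
  simp only [intSeries, PowerSeries.coeff_mk, PowerSeries.coeff_X_pow, Nat.cast_inj]

theorem intSeries_sub (f g : ℤ → ℤ) :
    intSeries (fun n => f n - g n) = intSeries f - intSeries g := by
  ext n
  simp [intSeries]

theorem intSeries_congr {f g : ℤ → ℤ} (h : ∀ n : ℕ, f n = g n) : intSeries f = intSeries g := by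
  ext n
  simpa [intSeries] using h n

theorem intSeries_semigroupInd_mul {p q : ℕ} (hp : 0 < p) (hq : 0 < q) (hpq : p.Coprime q) :
    intSeries (semigroupInd p q) * (1 - PowerSeries.X ^ q) * (1 - PowerSeries.X ^ p) =
      1 - PowerSeries.X ^ (p * q) := by
  have hp' : (0 : ℤ) < p := by exact_mod_cast hp
  have hq' : (0 : ℤ) < q := by exact_mod_cast hq
  have hneg : ∀ n < 0, semigroupInd p q n = 0 := fun n hn => semigroupInd_of_neg hp' hq' hn
  rw [intSeries_mul_one_sub_X_pow hneg, intSeries_mul_one_sub_X_pow fun n hn => by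
    rw [hneg n hn, hneg _ (by omega), sub_zero]]
  have h1 : (1 : PowerSeries ℤ) = PowerSeries.X ^ 0 := (pow_zero _).symm
  rw [h1, ← intSeries_single, ← intSeries_single, ← intSeries_sub]
  refine intSeries_congr fun n => ?_
  have := semigroupInd_recurrence hp' hq' (Nat.isCoprime_iff_coprime.2 hpq) n
  rw [show (n : ℤ) - p - q = n - q - p by ring]
  push_cast
  linarith

theorem intSeries_window_mul {p q : ℕ} (hp : 2 ≤ p) (hpq : p < q) :
    intSeries (window p q) * (1 - PowerSeries.X ^ (p * q)) * (1 - PowerSeries.X) =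
      (1 - PowerSeries.X ^ p) * (1 - PowerSeries.X ^ q) := by
  have hle := add_le_mul_of_lt (p := (p : ℤ)) (q := q) (by omega) (by omega)
  have hN : 0 < (p : ℤ) * q := by nlinarith
  -- c cuts the window off at negative arguments, as the shift lemma requires; d is a single period.
  set c : ℤ → ℤ := fun n => if 0 ≤ n then window p q n else 0 with hc
  set d : ℤ → ℤ := fun n => if 0 ≤ n ∧ n < p then 1 else if q ≤ n ∧ n < q + p then -1 else 0
    with hd
  have hcd : intSeries (window p q) * (1 - PowerSeries.X ^ (p * q)) = intSeries d := by
    rw [intSeries_congr (f := window p q) (g := c) fun n => by simp [hc],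
      intSeries_mul_one_sub_X_pow fun n hn => if_neg (by omega)]
    refine intSeries_congr fun n => ?_
    simp only [hd]
    push_cast
    rcases lt_or_ge (n : ℤ) (p * q) with h | h
    · rw [if_pos (by omega), if_neg (by omega), sub_zero,
        window_eq_of_modEq (Int.ModEq.refl _) (by omega) h]
      split_ifs <;> omega
    · rw [if_pos (by omega), if_pos (by omega),
        window_congr (p := (p : ℤ)) (q := q) (x := n - p * q) (y := n) (by simp), sub_self,
        if_neg (by omega), if_neg (by omega)]
  have h1 : (1 : PowerSeries ℤ) = PowerSeries.X ^ 0 := (pow_zero _).symm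
  have hR : (1 - PowerSeries.X ^ p) * (1 - PowerSeries.X ^ q) =
      (PowerSeries.X ^ 0 - PowerSeries.X ^ p) - (PowerSeries.X ^ q - PowerSeries.X ^ (q + p) :
        PowerSeries ℤ) := by ring
  have hX : (1 - PowerSeries.X : PowerSeries ℤ) = 1 - PowerSeries.X ^ 1 := by rw [pow_one]
  rw [hcd, hR, hX, intSeries_mul_one_sub_X_pow fun n hn => by
    simp only [hd]; rw [if_neg (by omega), if_neg (by omega)]]
  simp only [← intSeries_single, ← intSeries_sub]
  refine intSeries_congr fun n => ?_
  simp only [hd]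
  push_cast
  split_ifs <;> omega

end Series

/-! ### Coefficients of the binary and ternary polynomials. -/

theorem Finset.prod_powerset_singleton {α β : Type*} [CommMonoid β] (a : α)
    (f : Finset α → β) : ∏ T ∈ ({a} : Finset α).powerset, f T = f ∅ * f {a} := by
  classical
  rw [← insert_empty_eq, Finset.prod_powerset_insert (Finset.notMem_empty a)]
  simp

theorem inclExclPoly_pair_mul {p q : ℕ} (hp : 0 < p) (hq : 0 < q) (hne : p ≠ q)
    (hpq : p.Coprime q) :
    (X ^ q - 1) * (X ^ p - 1) * inclExclPoly {p, q} = (X ^ (p * q) - 1) * (X - 1) := by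
  have h := inclExclPoly_spec {p, q} (by simp [hp, hq]) (by
    simp only [Finset.coe_insert, Finset.coe_singleton]
    exact Set.pairwise_pair_of_symm.2 fun _ => hpq)
  have hp1 : p ∉ ({q} : Finset ℕ) := by simpa using hne
  rw [inclExclDen, inclExclNum, Finset.prod_filter, Finset.prod_filter] at h
  simp only [Finset.prod_powerset_insert hp1, Finset.prod_powerset_singleton] at h
  simp [Finset.sdiff_eq_filter, Finset.filter_insert, Finset.filter_singleton, hne, hne.symm] at h
  linear_combination h

theorem inclExclPoly_triple_mul {p q r : ℕ} (hp : 0 < p) (hq : 0 < q) (hr : 0 < r) (hne : p ≠ q)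
    (hpr' : p ≠ r) (hqr' : q ≠ r)
    (hpq : p.Coprime q) (hpr : p.Coprime r) (hqr : q.Coprime r) :
    (X ^ (q * r) - 1) * (X ^ (p * r) - 1) * (X ^ (p * q) - 1) * (X - 1) * inclExclPoly {p, q, r} =
      (X ^ (p * q * r) - 1) * (X ^ p - 1) * (X ^ q - 1) * (X ^ r - 1) := by
  have h := inclExclPoly_spec {p, q, r} (by simp [hp, hq, hr]) (by
    intro a ha b hb hab
    simp only [Finset.coe_insert, Finset.coe_singleton, Set.mem_insert_iff,
      Set.mem_singleton_iff] at ha hb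
    rcases ha with rfl | rfl | rfl <;> rcases hb with rfl | rfl | rfl <;>
      first | exact absurd rfl hab | assumption | (apply Nat.Coprime.symm; assumption))
  have hp1 : p ∉ ({q, r} : Finset ℕ) := by simp [hne, hpr']
  have hq1 : q ∉ ({r} : Finset ℕ) := by simpa using hqr'
  have hp2 : p ∉ ({q} : Finset ℕ) := by simpa using hne
  have hp3 : p ∉ ({r} : Finset ℕ) := by simpa using hpr'
  rw [inclExclDen, inclExclNum, Finset.prod_filter, Finset.prod_filter] at h
  simp only [Finset.prod_powerset_insert hp1, Finset.prod_powerset_insert hq1,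
    Finset.prod_powerset_singleton, insert_empty_eq, Finset.card_insert_of_notMem hp1,
    Finset.card_insert_of_notMem hp2, Finset.card_insert_of_notMem hp3,
    Finset.card_insert_of_notMem hq1, Finset.card_singleton, Finset.card_empty] at h
  simp [Finset.sdiff_eq_filter, Finset.filter_insert, Finset.filter_singleton, hne, hne.symm,
    hpr', hpr'.symm, hqr', hqr'.symm, Nat.even_add_one] at h
  linear_combination h

/-- Only exponents divisible by r contribute to the Cauchy product. -/
theorem coeff_expand_mul_intSeries {f : ℤ[X]} {a c : ℤ → ℤ} (hf : ∀ n : ℕ, f.coeff n = a n)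
    {r : ℕ} (hr : 0 < r) (n : ℕ) :
    PowerSeries.coeff n ((expand ℤ r f : PowerSeries ℤ) * intSeries c) =
      ∑ m ∈ Finset.range (n / r + 1), a m * c (n - r * m) := by
  rw [PowerSeries.coeff_mul, Finset.Nat.sum_antidiagonal_eq_sum_range_succ_mk]
  simp only [coeff_coe, intSeries, PowerSeries.coeff_mk, coeff_expand hr, ite_mul, zero_mul, hf]
  rw [← Finset.sum_filter]
  refine Finset.sum_nbij' (fun k => k / r) (fun m => r * m) ?_ ?_ ?_ ?_ ?_
  · intro k hk
    simp only [Finset.mem_filter, Finset.mem_range] at hk ⊢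
    exact Nat.lt_succ_of_le (Nat.div_le_div_right (by omega))
  · intro m hm
    simp only [Finset.mem_filter, Finset.mem_range] at hm ⊢
    refine ⟨Nat.lt_succ_of_le ?_, dvd_mul_right _ _⟩
    exact (Nat.mul_le_mul_left r (by omega)).trans (Nat.mul_div_le n r)
  · intro k hk
    exact Nat.mul_div_cancel' (Finset.mem_filter.1 hk).2
  · intro m _
    exact Nat.mul_div_cancel_left m hr
  · intro k hk
    simp only [Finset.mem_filter, Finset.mem_range] at hk
    rw [Nat.cast_sub (by omega), ← Nat.cast_mul, Nat.mul_div_cancel' hk.2]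

theorem PowerSeries.X_pow_sub_one_ne_zero {k : ℕ} (hk : 0 < k) :
    (PowerSeries.X ^ k - 1 : PowerSeries ℤ) ≠ 0 := by
  intro h
  have := congrArg (PowerSeries.coeff 0) h
  simp [hk.ne'] at this

theorem inclExclPoly_pair_coeff {p q : ℕ} (hp : 0 < p) (hq : 0 < q) (hne : p ≠ q)
    (hpq : p.Coprime q) (n : ℕ) : (inclExclPoly {p, q}).coeff n = binaryCoeff p q n := by
  have hp' : (0 : ℤ) < p := by exact_mod_cast hp
  have hq' : (0 : ℤ) < q := by exact_mod_cast hq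
  have hpoly := congrArg (fun f : ℤ[X] => (f : PowerSeries ℤ)) (inclExclPoly_pair_mul hp hq hne hpq)
  simp only [coe_mul, coe_sub, coe_pow, coe_X, coe_one] at hpoly
  have hser := intSeries_semigroupInd_mul hp hq hpq
  have hdiff : intSeries (semigroupInd p q) * (1 - PowerSeries.X) = intSeries (binaryCoeff p q) := by
    have := intSeries_mul_one_sub_X_pow (f := semigroupInd p q)
      (fun n hn => semigroupInd_of_neg hp' hq' hn) 1
    rw [pow_one] at this
    rw [this]
    exact intSeries_congr fun n => by simp [binaryCoeff]
  have key : (inclExclPoly {p, q} : PowerSeries ℤ) = intSeries (binaryCoeff p q) := by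
    refine mul_left_cancel₀ (mul_ne_zero (PowerSeries.X_pow_sub_one_ne_zero hq)
      (PowerSeries.X_pow_sub_one_ne_zero hp)) ?_
    rw [hpoly, ← hdiff]
    linear_combination (-(1 - PowerSeries.X)) * hser
  rw [← coeff_coe, key, intSeries, PowerSeries.coeff_mk]

theorem coeff_expand_pair_mul_window {p q r : ℕ} (hp : 0 < p) (hq : 0 < q) (hr : 0 < r)
    (hne : p ≠ q) (hpq : p.Coprime q) (n : ℕ) :
    PowerSeries.coeff n
      ((expand ℤ r (inclExclPoly {p, q}) : PowerSeries ℤ) * intSeries (window p q)) =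
      windowSum p q r (n / r : ℕ) n := by
  rw [coeff_expand_mul_intSeries (inclExclPoly_pair_coeff hp hq hne hpq) hr, windowSum,
    ← Nat.cast_succ, Int.toNat_natCast]

/-- This is Q_{p,q,r}(z) = Q_{p,q}(z^r) W(z), checked after clearing denominators. -/
theorem inclExclPoly_triple_coeff {p q r : ℕ} (hp : 2 ≤ p) (hpq' : p < q) (hr : 2 ≤ r)
    (hpq : p.Coprime q) (hpr : p.Coprime r) (hqr : q.Coprime r) (n : ℕ) :
    (inclExclPoly {p, q, r}).coeff n = windowSum p q r (n / r : ℕ) n := by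
  have hq : 2 ≤ q := by omega
  have hpr' : p ≠ r := by rintro rfl; rw [Nat.coprime_self] at hpr; omega
  have hqr' : q ≠ r := by rintro rfl; rw [Nat.coprime_self] at hqr; omega
  rw [← coeff_expand_pair_mul_window (by omega) (by omega) (by omega) hpq'.ne hpq, ← coeff_coe]
  congr 1
  have h3 := congrArg (fun f : ℤ[X] => (f : PowerSeries ℤ)) (inclExclPoly_triple_mul
    (p := p) (q := q) (r := r) (by omega) (by omega) (by omega) hpq'.ne hpr' hqr' hpq hpr hqr)
  have h2 := congrArg (fun f : ℤ[X] => (expand ℤ r f : PowerSeries ℤ))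
    (inclExclPoly_pair_mul (p := p) (q := q) (by omega) (by omega) hpq'.ne hpq)
  simp only [map_mul, map_sub, map_pow, expand_X, map_one, ← pow_mul, coe_mul, coe_sub, coe_pow,
    coe_X, coe_one] at h2 h3
  have hw := intSeries_window_mul hp hpq'
  have hX : (PowerSeries.X - 1 : PowerSeries ℤ) ≠ 0 := by
    simpa using PowerSeries.X_pow_sub_one_ne_zero one_pos
  refine mul_left_cancel₀ (mul_ne_zero (mul_ne_zero (mul_ne_zero
    (PowerSeries.X_pow_sub_one_ne_zero (k := q * r) (Nat.mul_pos (by omega) (by omega)))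
    (PowerSeries.X_pow_sub_one_ne_zero (k := p * r) (Nat.mul_pos (by omega) (by omega))))
    (PowerSeries.X_pow_sub_one_ne_zero (k := p * q) (Nat.mul_pos (by omega) (by omega)))) hX) ?_
  rw [h3]
  rw [mul_comm r q, mul_comm r p, mul_comm r (p * q)] at h2
  linear_combination (-(1 - PowerSeries.X ^ p) * (1 - PowerSeries.X ^ q)) * h2 -
    ((PowerSeries.X ^ (q * r) - 1) * (PowerSeries.X ^ (p * r) - 1) *
      (expand ℤ r (inclExclPoly {p, q}) : PowerSeries ℤ)) * hw

/-- For r = 1 the product Q_{p,q}(z) W(z) equals 1. -/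
theorem windowSum_one_eq {p q : ℕ} (hp : 2 ≤ p) (hpq' : p < q) (hpq : p.Coprime q) {M t : ℤ}
    (ht : t ≡ M [ZMOD p * q]) : windowSum p q 1 M t = if M = 0 then 1 else 0 := by
  rcases lt_or_ge M 0 with hM | hM
  · rw [windowSum_of_neg hM, if_neg hM.ne]
  lift M to ℕ using hM
  have h := coeff_expand_pair_mul_window (p := p) (q := q) (r := 1) (by omega) (by omega) one_pos
    hpq'.ne hpq M
  rw [Nat.div_one, Nat.cast_one] at h
  rw [windowSum_congr (Int.ModEq.refl 1) ht, ← h, expand_one]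
  have h2 := congrArg (fun f : ℤ[X] => (f : PowerSeries ℤ))
    (inclExclPoly_pair_mul (p := p) (q := q) (by omega) (by omega) hpq'.ne hpq)
  simp only [coe_mul, coe_sub, coe_pow, coe_X, coe_one] at h2
  have hw := intSeries_window_mul hp hpq'
  have hX : (PowerSeries.X - 1 : PowerSeries ℤ) ≠ 0 := by
    simpa using PowerSeries.X_pow_sub_one_ne_zero one_pos
  have key : (inclExclPoly {p, q} : PowerSeries ℤ) * intSeries (window p q) = 1 := by
    refine mul_left_cancel₀ (mul_ne_zero
      (PowerSeries.X_pow_sub_one_ne_zero (k := p * q) (Nat.mul_pos (by omega) (by omega))) hX) ?_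
    linear_combination h2 + (inclExclPoly {p, q} : PowerSeries ℤ) * hw
  rw [key, PowerSeries.coeff_one]
  simp

/-! ### Heights and the final comparison. -/

theorem inclExclHeight_le_iff {ρ : Finset ℕ} {B : ℕ} :
    inclExclHeight ρ ≤ B ↔ ∀ n, |(inclExclPoly ρ).coeff n| ≤ B := by
  rw [inclExclHeight, Finset.sup_le_iff]
  constructor
  · intro h n
    by_cases hn : n ∈ (inclExclPoly ρ).support
    · have := h n hn
      rw [Int.abs_eq_natAbs]
      exact_mod_cast this
    · rw [notMem_support_iff.1 hn]
      simp
  · intro h n _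
    have := h n
    rw [Int.abs_eq_natAbs] at this
    exact_mod_cast this

/-- The height `A(p, q, r)` bounds the partial sums at all positions below `r`. -/
theorem abs_windowSum_le_height {p q r : ℕ} (hp : 2 ≤ p) (hpq' : p < q) (hr : 2 ≤ r)
    (hpq : p.Coprime q) (hpr : p.Coprime r) (hqr : q.Coprime r) {M t x : ℤ} (hx0 : 0 ≤ x)
    (hxr : x < r) (ht : t ≡ r * M + x [ZMOD p * q]) :
    |windowSum p q r M t| ≤ inclExclHeight {p, q, r} := by
  rcases lt_or_ge M 0 with hM | hM
  · simp [windowSum_of_neg hM]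
  lift M to ℕ using hM
  lift x to ℕ using hx0
  have h := (inclExclHeight_le_iff (ρ := {p, q, r})).1 le_rfl (r * M + x)
  rw [inclExclPoly_triple_coeff hp hpq' hr hpq hpr hqr, Nat.mul_add_div (by omega),
    Nat.div_eq_of_lt (by omega), add_zero] at h
  rw [windowSum_congr (Int.ModEq.refl _) ht]
  exact_mod_cast h

theorem ternaryHeight_comm (p q r : ℕ) : ternaryHeight p q r = ternaryHeight q p r := by
  rw [ternaryHeight, ternaryHeight, Finset.insert_comm]

theorem Nat.Coprime.of_modEq_or_neg {p N r s : ℕ} (hpN : p ∣ N) (hpr : p.Coprime r)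
    (hrs : (r : ℤ) ≡ s [ZMOD N] ∨ (r : ℤ) ≡ -s [ZMOD N]) : p.Coprime s := by
  rw [← Nat.isCoprime_iff_coprime] at hpr ⊢
  have hpN' : (p : ℤ) ∣ N := by exact_mod_cast hpN
  rcases hrs with h | h
  · obtain ⟨k, hk⟩ := hpN'.trans h.dvd
    rw [show (s : ℤ) = r + p * k by linarith]
    exact IsCoprime.add_mul_left_right hpr k
  · obtain ⟨k, hk⟩ := hpN'.trans h.dvd
    rw [← IsCoprime.neg_right_iff, show -(s : ℤ) = r + p * k by linarith]
    exact IsCoprime.add_mul_left_right hpr k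

theorem abs_windowSum_of_modEq_or_neg {p q r s : ℤ} (hp : 2 ≤ p) (hpq : p < q)
    (hrs : r ≡ s [ZMOD p * q] ∨ r ≡ -s [ZMOD p * q]) (M t : ℤ) :
    ∃ t', |windowSum p q r M t| = |windowSum p q s M t'| := by
  rcases hrs with h | h
  · exact ⟨t, by rw [windowSum_congr h (Int.ModEq.refl t)]⟩
  · exact ⟨p + q - 1 - t, by
      rw [windowSum_congr h (Int.ModEq.refl t), windowSum_neg hp hpq, abs_neg]⟩

theorem ternaryHeight_bounds_of_lt {p q r s : ℕ} (hp : 2 ≤ p) (hpq' : p < q)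
    (hpq : p.Coprime q) (hpr : p.Coprime r) (hqr : q.Coprime r) (hs : 1 ≤ s) (hr : q < r)
    (hrs : (r : ℤ) ≡ s [ZMOD ((p * q : ℕ) : ℤ)] ∨ (r : ℤ) ≡ -s [ZMOD ((p * q : ℕ) : ℤ)]) :
    ternaryHeight p q s ≤ ternaryHeight p q r ∧
      ternaryHeight p q r ≤ ternaryHeight p q s + 1 := by
  have hps := hpr.of_modEq_or_neg (dvd_mul_right p q) hrs
  have hqs := hqr.of_modEq_or_neg (dvd_mul_left q p) hrs
  have hrs' : (s : ℤ) ≡ r [ZMOD p * q] ∨ (s : ℤ) ≡ -r [ZMOD p * q] := by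
    rw [← Nat.cast_mul]
    refine hrs.imp Int.ModEq.symm fun h => ?_
    simpa using h.neg.symm
  rw [Nat.cast_mul] at hrs
  have hp' : (2 : ℤ) ≤ p := by exact_mod_cast hp
  have hpq'' : (p : ℤ) < q := by exact_mod_cast hpq'
  have hr1 : r ≠ 1 := by omega
  have hbound : ∀ M t : ℤ, |windowSum p q r M t| ≤ inclExclHeight {p, q, r} :=
    abs_windowSum_le hp' hpq'' (by exact_mod_cast hr) fun M t x hx hxr ht =>
      abs_windowSum_le_height hp hpq' (by omega) hpq hpr hqr hx hxr ht
  rw [ternaryHeight, ternaryHeight, if_neg hr1]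
  rcases hs.eq_or_lt with rfl | hs2
  · refine ⟨by simp, inclExclHeight_le_iff.2 fun n => ?_⟩
    rw [inclExclPoly_triple_coeff hp hpq' (by omega) hpq hpr hqr]
    obtain ⟨t', ht'⟩ := abs_windowSum_of_modEq_or_neg hp' hpq'' hrs (n / r : ℕ) n
    rw [ht']
    simpa using abs_windowSum_one_le_one hp' hpq''
      (fun M t ht => windowSum_one_eq hp hpq' hpq ht) (n / r : ℕ) t'
  · rw [if_neg (by omega)]
    constructor <;> refine inclExclHeight_le_iff.2 fun n => ?_
    · rw [inclExclPoly_triple_coeff hp hpq' hs2 hpq hps hqs]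
      obtain ⟨t', ht'⟩ := abs_windowSum_of_modEq_or_neg hp' hpq'' hrs' (n / s : ℕ) n
      rw [ht']
      -- The transferred pair need not come from a coefficient of Q_{p,q,r}, hence the bound over
      -- all pairs.
      exact hbound _ _
    · rw [inclExclPoly_triple_coeff hp hpq' (by omega) hpq hpr hqr]
      obtain ⟨t', ht'⟩ := abs_windowSum_of_modEq_or_neg hp' hpq'' hrs (n / r : ℕ) n
      rw [ht', Nat.cast_add, Nat.cast_one]
      exact abs_windowSum_le_add_one hp' hpq'' (by exact_mod_cast hs)
        (fun M t x hx hxs ht => abs_windowSum_le_height hp hpq' hs2 hpq hps hqs hx hxs ht) _ _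

theorem theorem4 (p q r s : ℕ) (hp : 3 ≤ p) (hq : 3 ≤ q)
    (hpq : Nat.Coprime p q) (hpr : Nat.Coprime p r) (hqr : Nat.Coprime q r)
    (hs : 1 ≤ s) (hsmax : s < max p q) (hrmax : max p q < r)
    (hrs : (r : ℤ) ≡ (s : ℤ) [ZMOD ((p * q : ℕ) : ℤ)] ∨
      (r : ℤ) ≡ -(s : ℤ) [ZMOD ((p * q : ℕ) : ℤ)]) :
    ternaryHeight p q s ≤ ternaryHeight p q r ∧
      ternaryHeight p q r ≤ ternaryHeight p q s + 1 := by
  rcases lt_trichotomy p q with h | rfl | h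
  · exact ternaryHeight_bounds_of_lt (by omega) h hpq hpr hqr hs (by omega) hrs
  · rw [Nat.coprime_self] at hpq
    omega
  · rw [ternaryHeight_comm p, ternaryHeight_comm p]
    rw [mul_comm p q] at hrs
    exact ternaryHeight_bounds_of_lt (by omega) h hpq.symm hqr hpr hs (by omega) hrs
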